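/- Let $K$ items have merits $\mu=(\mu_1,\dots,\mu_K)^\top\in\mathbb R^K$ with $\sum_i\mu_i=0$. For $i<j$ and $k\ge 1$ let $Y_{ijk}=\mu_i-\mu_j+\epsilon_{ijk}$, where the errors $\epsilon_{ijk}$ ($i<j$, $k\ge1$) are IID with mean $0$ and finite variance $\sigma^2$. Consider a sequence of comparison designs: in each of them items $i\ne j$ are compared $n_{ij}=n_{ji}\ge 0$ times (with outcomes $Y_{ij1},\dots,Y_{ijn_{ij}}$ for $i<j$), $n=\sum_{i<j}n_{ij}$ is the total number of comparisons, and $n\to\infty$ along the sequence; $K$, $\mu$ and the error distribution are fixed. Let $N$ be the $K\times K$ Laplacian, $N_{ii}=\sum_{j\ne i}n_{ij}$ and $N_{ij}=-n_{ij}$ for $i\neq j$. Let the (measurable) least squares estimator $\widehat\mu_n$ be a minimizer of $\sum_{i<j}\sum_{k=1}^{n_{ij}}\bigl(Y_{ijk}-(m_i-m_j)\bigr)^2$ over all $m\in\mathbb R^K$ with $\sum_i m_i=0$. Assume that there are a fixed spanning tree $\mathcal T$ on the $K$ items and a constant $c\in(0,\infty)$ such that $\min\{n_{ij}:(i,j)\in\mathcal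 T\}/n\to c$, and that the limit $\Theta=\lim N/n$ exists. Then $\Theta$ has rank $K-1$ and $$\sqrt n\,(\widehat\mu_n-\mu)\ \Rightarrow\ \mathcal N_K(0,\sigma^2\Theta^+)$$ in distribution, where $\Theta^+$ is the Moore–Penrose inverse of $\Theta$. -/

import Mathlib

open MeasureTheory ProbabilityTheory Filter Topology

namespace PairedComparison

/-- Pairs of items `i < j`; each unordered pair of distinct items is listed once. -/
abbrev Pair (K : ℕ) : Type := {p : Fin K × Fin K // p.1 < p.2}

/-- A comparison design on `K` items: `count i j` is the number `n_ij = n_ji` of comparisons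
between the distinct items `i` and `j`. -/
structure Design (K : ℕ) where
  count : Fin K → Fin K → ℕ
  count_symm : ∀ i j, count i j = count j i
  count_self : ∀ i, count i i = 0

variable {K : ℕ}

/-- The total number of comparisons `n = ∑_{i<j} n_ij`. -/
def Design.total (D : Design K) : ℕ := ∑ p : Pair K, D.count p.1.1 p.1.2

/-- The Laplacian `N`: `N_ii = ∑_j n_ij` and `N_ij = -n_ij` for `i ≠ j`. -/
def Design.laplacian (D : Design K) : Matrix (Fin K) (Fin K) ℝ :=
  Matrix.of fun i j => if i = j then ∑ l, (D.count i l : ℝ) else -(D.count i j : ℝ)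

/-- `min {n_ij : (i,j) ∈ T}` (an infimum of natural numbers, hence attained as soon as `T` has
an edge). -/
noncomputable def Design.minCount (D : Design K) (T : SimpleGraph (Fin K)) : ℕ :=
  sInf {m : ℕ | ∃ i j, T.Adj i j ∧ m = D.count i j}

/-- The rate condition for a sequence of designs: for some spanning tree `T` on the `K` items,
`min {n_ij : (i,j) ∈ T} / n → c` with `c > 0`. As `c > 0`, the edges of `T` are eventually edges
of the comparison graph `{(i,j) : n_ij > 0}`. -/
def SpanningTreeRate (D : ℕ → Design K) : Prop :=
  ∃ T : SimpleGraph (Fin K), T.IsTree ∧ ∃ c : ℝ, 0 < c ∧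
    Tendsto (fun t => ((D t).minCount T : ℝ) / ((D t).total : ℝ)) atTop (𝓝 c)

/-- IID errors with mean zero and finite variance `σ ^ 2`. The index runs over pairs `i < j`
and repetitions `k`. -/
structure IIDErrors {Ω : Type*} [MeasurableSpace Ω] (ε : Pair K → ℕ → Ω → ℝ)
    (P : Measure Ω) (σ : ℝ) : Prop where
  indep : iIndepFun (fun q : Pair K × ℕ => ε q.1 q.2) P
  ident : ∀ q r : Pair K × ℕ, IdentDistrib (ε q.1 q.2) (ε r.1 r.2) P P
  memLp : ∀ p k, MemLp (ε p k) 2 P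
  mean_zero : ∀ p k, ∫ ω, ε p k ω ∂P = 0
  variance_eq : ∀ p k, Var[ε p k; P] = σ ^ 2

/-- The outcome `Y_ijk = μ_i - μ_j + ε_ijk` of the `k`-th comparison of `i < j`. The reversed
outcome is `Y_jik = -Y_ijk`, so the pairs `i < j` carry all the data. -/
def outcome {Ω : Type*} (μ : EuclideanSpace ℝ (Fin K)) (ε : Pair K → ℕ → Ω → ℝ)
    (ω : Ω) (p : Pair K) (k : ℕ) : ℝ :=
  μ p.1.1 - μ p.1.2 + ε p k ω

/-- The sum of squares `Q(m) = ∑_{i<j} ∑_{k < n_ij} (y_ijk - (m_i - m_j))²`. -/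
def sumSq (D : Design K) (y : Pair K → ℕ → ℝ) (m : EuclideanSpace ℝ (Fin K)) : ℝ :=
  ∑ p : Pair K, ∑ k ∈ Finset.range (D.count p.1.1 p.1.2),
    (y p k - (m p.1.1 - m p.1.2)) ^ 2

/-- `m` is a least squares estimate: a minimizer of `Q` subject to `∑ i, m_i = 0`. -/
def IsLSE (D : Design K) (y : Pair K → ℕ → ℝ) (m : EuclideanSpace ℝ (Fin K)) : Prop :=
  ∑ i, m i = 0 ∧
    ∀ m' : EuclideanSpace ℝ (Fin K), ∑ i, m' i = 0 → sumSq D y m ≤ sumSq D y m'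

/-- `B` is the Moore–Penrose inverse of the real matrix `A` (the four Penrose equations). -/
structure IsMoorePenrose (A B : Matrix (Fin K) (Fin K) ℝ) : Prop where
  mul_mul_left : A * B * A = A
  mul_mul_right : B * A * B = B
  symm_left : (A * B).transpose = A * B
  symm_right : (B * A).transpose = B * A

/-- The Moore–Penrose inverse is unique. -/
theorem IsMoorePenrose.unique {A B C : Matrix (Fin K) (Fin K) ℝ}
    (hB : IsMoorePenrose A B) (hC : IsMoorePenrose A C) : B = C := by
  have h1 : A * B = A * C := by
    calc A * B = (A * B).transpose := hB.symm_left.symm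
      _ = (A * C * (A * B)).transpose := by
        rw [← Matrix.mul_assoc, hC.mul_mul_left]
      _ = A * B * (A * C) := by rw [Matrix.transpose_mul, hB.symm_left, hC.symm_left]
      _ = A * C := by rw [← Matrix.mul_assoc, hB.mul_mul_left]
  have h2 : B * A = C * A := by
    calc B * A = (B * A).transpose := hB.symm_right.symm
      _ = (B * A * (C * A)).transpose := by
        rw [Matrix.mul_assoc, ← Matrix.mul_assoc A, hC.mul_mul_left]
      _ = C * A * (B * A) := by rw [Matrix.transpose_mul, hB.symm_right, hC.symm_right]
      _ = C * A := by rw [Matrix.mul_assoc, ← Matrix.mul_assoc A, hB.mul_mul_left]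
  calc B = B * A * B := hB.mul_mul_right.symm
    _ = C * A * C := by rw [h2, Matrix.mul_assoc, h1, ← Matrix.mul_assoc]
    _ = C := hC.mul_mul_right

end PairedComparison

/-!
The estimation error `d = μ̂ - μ` has zero sum and solves the normal equations `N d = S`, where `S`
collects the errors. Let `J` be the projection onto constant vectors (`meanMatrix`). As `J d = 0`,
the vector `d` also solves `(N / n + J) d = S / n`, and this system is nonsingular for large `n` because
its matrix tends to `Θ + J`, which is invertible: `Θ` is a limit of Laplacians, so its quadratic form
is `∑_{i<j} θ_ij (x_i - x_j)²` with `θ_ij = lim n_ij / n`, and `θ_ij ≥ c > 0` on the edges of the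
spanning tree, which forces `ker Θ` to consist of the constant vectors. The same fact gives the rank,
and `Θ⁺ = (Θ + J)⁻¹ - J = (Θ + J)⁻¹ Θ (Θ + J)⁻¹` (`isMoorePenrose_inv_add_meanMatrix`).

For a fixed vector `x` put `y = (N / n + J)⁻¹ x`, which converges to `z = (Θ + J)⁻¹ x`. Then
`⟪√n d, x⟫ = n^{-1/2} ∑_{i<j} (y_i - y_j) ∑_k ε_ijk` (`IsLSE.dotProduct_sqrt_total_smul`), so the
characteristic function of `√n d` at `x` is the product over the pairs of the powers
`φ ((y_i - y_j) / √n) ^ n_ij`, where `φ` is the characteristic function of one error. The second-order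
expansion of `φ` at `0` shows that each factor tends to `exp (-σ² θ_ij (z_i - z_j)² / 2)`
(`tendsto_charFun_pow`); this needs only `n_ij / n → θ_ij`, so pairs that are compared rarely or never
require no separate treatment. The product of the limits is
`exp (-σ² zᵀ Θ z / 2) = exp (-σ² xᵀ Θ⁺ x / 2)`, and Lévy's convergence theorem concludes.
-/

namespace PairedComparison

open Matrix

variable {K : ℕ}

/-! ### Characteristic functions -/

/-- The second-order expansion at `0` of the characteristic function of a centred variable, of any
variance. -/
theorem charFun_sub_taylor_two_isLittleO {Ω : Type*} [MeasurableSpace Ω] {P : Measure Ω}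
    [IsProbabilityMeasure P] {X : Ω → ℝ} (hX : MemLp X 2 P) (h0 : P[X] = 0) :
    (fun t : ℝ => charFun (P.map X) t - (1 - (Var[X; P] : ℂ) * (t : ℂ) ^ 2 / 2))
      =o[𝓝 0] fun t : ℝ => t ^ 2 := by
  have hXm : AEMeasurable X P := hX.aestronglyMeasurable.aemeasurable
  have : IsProbabilityMeasure (P.map X) := Measure.isProbabilityMeasure_map hXm
  have hid : MemLp id 2 (P.map X) := by
    rw [memLp_map_measure_iff aestronglyMeasurable_id hXm]
    exact hX
  have hvar : Var[X; P] = P[X ^ 2] := variance_of_integral_eq_zero hXm h0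
  have key : ∀ t : ℝ, taylorWithinEval (charFun (P.map X)) 2 Set.univ 0 t =
      1 - (Var[X; P] : ℂ) * (t : ℂ) ^ 2 / 2 := fun t => by
    rw [taylorWithinEval_charFun_two_zero hXm hid, h0, hvar]
    simp
  simp_rw [← key]
  have h := taylor_isLittleO_univ (x₀ := (0 : ℝ)) (n := 2) (f := charFun (P.map X))
    (contDiff_charFun hid)
  simpa using h

/-- The limit of powers of a characteristic function along vanishing arguments. No growth of `m`
is needed beyond the convergence of `m * s ^ 2`, so bounded numbers of summands are covered. -/
theorem tendsto_charFun_pow {ι Ω : Type*} [MeasurableSpace Ω] {P : Measure Ω}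
    [IsProbabilityMeasure P] {X : Ω → ℝ} (hX : MemLp X 2 P) (h0 : P[X] = 0) {l : Filter ι}
    {s : ι → ℝ} {m : ι → ℕ} {a : ℝ} (hs : Tendsto s l (𝓝 0))
    (hm : Tendsto (fun i => (m i : ℝ) * s i ^ 2) l (𝓝 a)) :
    Tendsto (fun i => charFun (P.map X) (s i) ^ m i) l
      (𝓝 (Complex.exp (-((Var[X; P] : ℂ) * a / 2)))) := by
  have hXm : AEMeasurable X P := hX.aestronglyMeasurable.aemeasurable
  have : IsProbabilityMeasure (P.map X) := Measure.isProbabilityMeasure_map hXm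
  set φ := charFun (P.map X) with hφ
  set v : ℂ := (Var[X; P] : ℂ) with hv
  have hT : (fun t : ℝ => φ t - (1 - v * (t : ℂ) ^ 2 / 2)) =o[𝓝 0] fun t : ℝ => t ^ 2 :=
    charFun_sub_taylor_two_isLittleO hX h0
  have hφ1 : Tendsto φ (𝓝 0) (𝓝 1) := by
    have h := (continuous_charFun (μ := P.map X)).tendsto 0
    simpa using h
  have hO : (fun t : ℝ => φ t - 1) =O[𝓝 0] fun t : ℝ => t ^ 2 := by
    have h1 : (fun t : ℝ => -(v * (t : ℂ) ^ 2 / 2)) =O[𝓝 0] fun t : ℝ => t ^ 2 := by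
      refine Asymptotics.IsBigO.of_bound (‖v‖ / 2) (Eventually.of_forall fun t => ?_)
      simp
      apply le_of_eq
      ring
    refine (hT.isBigO.add h1).congr_left fun t => ?_
    ring
  have hlog : (fun t : ℝ => Complex.log (φ t) - (φ t - 1)) =o[𝓝 0] fun t : ℝ => t ^ 2 := by
    have hd : HasDerivAt Complex.log 1 1 := by
      simpa using Complex.hasDerivAt_log (z := 1) (by simp)
    have h := (hasDerivAt_iff_isLittleO.1 hd).comp_tendsto hφ1
    refine (h.congr_left fun t => ?_).trans_isBigO hO
    simp
  have hloss : (fun t : ℝ => Complex.log (φ t) + v * (t : ℂ) ^ 2 / 2) =o[𝓝 0]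
      fun t : ℝ => t ^ 2 := by
    refine (hlog.add hT).congr_left fun t => ?_
    ring
  have h1 : (fun i => (m i : ℂ) * (Complex.log (φ (s i)) + v * (s i : ℂ) ^ 2 / 2)) =o[l]
      fun i => (m i : ℝ) * s i ^ 2 :=
    (Asymptotics.IsBigO.of_bound 1 (by simp)).mul_isLittleO (hloss.comp_tendsto hs)
  have h2 := h1.trans_isBigO (hm.isBigO_one ℝ)
  rw [Asymptotics.isLittleO_one_iff] at h2
  have h3 : Tendsto (fun i => (((m i : ℝ) * s i ^ 2 : ℝ) : ℂ)) l (𝓝 (a : ℂ)) :=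
    (Complex.continuous_ofReal.tendsto a).comp hm
  have h4 : Tendsto (fun i => (m i : ℂ) * Complex.log (φ (s i))) l (𝓝 (-(v * a / 2))) := by
    have h5 := h2.sub ((h3.const_mul v).div_const 2)
    rw [zero_sub] at h5
    refine h5.congr fun i => ?_
    push_cast
    ring
  refine ((Complex.continuous_exp.tendsto _).comp h4).congr' ?_
  filter_upwards [(hφ1.comp hs).eventually_ne one_ne_zero] with i hi
  rw [Function.comp_apply, Complex.exp_nat_mul]
  exact congrArg (· ^ m i) (Complex.exp_log hi)

/-- The characteristic function of a weighted sum of the errors, the weight depending only on the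
pair compared. -/
theorem IIDErrors.charFun_sum {Ω : Type*} [MeasurableSpace Ω] {P : Measure Ω}
    {ε : Pair K → ℕ → Ω → ℝ} {σ : ℝ} (hε : IIDErrors ε P σ) (c : Pair K → ℝ) (n : Pair K → ℕ)
    (u : ℝ) :
    charFun (P.map fun ω => ∑ p, ∑ k ∈ Finset.range (n p), c p * ε p k ω) u =
      ∏ p, charFun (P.map (ε p 0)) (c p * u) ^ n p := by
  have hm : ∀ p k, AEMeasurable (ε p k) P := fun p k =>
    (hε.memLp p k).aestronglyMeasurable.aemeasurable
  have hinj : Function.Injective fun q : (Σ p : Pair K, Fin (n p)) => (q.1, (q.2 : ℕ)) := by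
    rintro ⟨p, i⟩ ⟨q, j⟩ h
    simp only [Prod.mk.injEq] at h
    obtain ⟨rfl, h2⟩ := h
    rw [Fin.ext h2]
  have hind : iIndepFun (fun (q : Σ p : Pair K, Fin (n p)) ω => c q.1 * ε q.1 q.2 ω) P :=
    (hε.indep.precomp hinj).comp (fun (q : Σ p : Pair K, Fin (n p)) x => c q.1 * x) fun _ => by fun_prop
  have h := hind.charFun_map_fun_sum_eq_prod
    fun q : (Σ p : Pair K, Fin (n p)) => (hm q.1 q.2).const_mul _
  have hsum : (fun ω => ∑ p, ∑ k ∈ Finset.range (n p), c p * ε p k ω) =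
      fun ω => ∑ q : (Σ p : Pair K, Fin (n p)), c q.1 * ε q.1 q.2 ω := by
    funext ω
    rw [Fintype.sum_sigma]
    exact Finset.sum_congr rfl fun p _ => Finset.sum_range _
  rw [hsum, h, Finset.prod_apply, Fintype.prod_sigma]
  refine Finset.prod_congr rfl fun p _ => ?_
  have h2 : ∀ k : Fin (n p), charFun (P.map fun ω => c p * ε p k ω) u =
      charFun (P.map (ε p 0)) (c p * u) := fun k => by
    rw [charFun_map_mul_comp (hm p k), (hε.ident (p, (k : ℕ)) (p, 0)).map_eq]
  simp [h2]

/-! ### Laplacians and their bilinear forms -/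

/-- Each unordered pair of distinct items is counted twice in the double sum. -/
theorem sum_sum_eq_two_mul_sum_pair (f : Fin K → Fin K → ℝ) (hs : ∀ i j, f i j = f j i)
    (h0 : ∀ i, f i i = 0) : ∑ i, ∑ j, f i j = 2 * ∑ p : Pair K, f p.1.1 p.1.2 := by
  have hlt : ∑ p : Pair K, f p.1.1 p.1.2 = ∑ i, ∑ j, if i < j then f i j else 0 := by
    rw [← Fintype.sum_prod_type' (fun i j => if i < j then f i j else 0), ← Finset.sum_filter]
    exact (Finset.sum_subtype _ (by simp) fun q : Fin K × Fin K => f q.1 q.2).symm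
  have hgt : ∑ i, ∑ j, (if i < j then f i j else 0) = ∑ i, ∑ j, if j < i then f i j else 0 := by
    rw [Finset.sum_comm]
    simp_rw [hs]
  rw [hlt, two_mul]
  nth_rewrite 2 [hgt]
  rw [← Finset.sum_add_distrib]
  refine Finset.sum_congr rfl fun i _ => ?_
  rw [← Finset.sum_add_distrib]
  refine Finset.sum_congr rfl fun j _ => ?_
  rcases lt_trichotomy i j with h | rfl | h
  · simp [h, h.not_gt]
  · simp [h0]
  · simp [h, h.not_gt]

/-- The bilinear form of a symmetric matrix with zero row sums. -/
theorem dotProduct_mulVec_eq_sum_pair {A : Matrix (Fin K) (Fin K) ℝ} (hA : A.IsSymm)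
    (h1 : A *ᵥ 1 = 0) (y z : Fin K → ℝ) :
    y ⬝ᵥ A *ᵥ z = ∑ p : Pair K, -A p.1.1 p.1.2 * ((y p.1.1 - y p.1.2) * (z p.1.1 - z p.1.2)) := by
  have hrow : ∀ i, ∑ j, A i j = 0 := fun i => by
    simpa [mulVec, dotProduct] using congrFun h1 i
  have hcol : ∀ j, ∑ i, A i j = 0 := fun j => by
    simpa [hA.apply] using hrow j
  have h := sum_sum_eq_two_mul_sum_pair (fun i j => -A i j * ((y i - y j) * (z i - z j)))
    (fun i j => by rw [hA.apply]; ring) (fun i => by simp)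
  have e : ∀ i j, -A i j * ((y i - y j) * (z i - z j)) =
      y i * (A i j * z j) + y j * (A i j * z i) - (y i * z i) * A i j - A i j * (y j * z j) :=
    fun i j => by ring
  simp_rw [e, Finset.sum_sub_distrib, Finset.sum_add_distrib] at h
  have t1 : ∑ i, ∑ j, y i * (A i j * z j) = y ⬝ᵥ A *ᵥ z := by
    simp [dotProduct, mulVec, Finset.mul_sum]
  have t2 : ∑ i, ∑ j, y j * (A i j * z i) = y ⬝ᵥ A *ᵥ z := by
    rw [Finset.sum_comm, ← t1]
    simp_rw [hA.apply]
  have t3 : ∑ i, ∑ j, (y i * z i) * A i j = 0 := by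
    simp [← Finset.mul_sum, hrow]
  have t4 : ∑ i, ∑ j, A i j * (y j * z j) = 0 := by
    rw [Finset.sum_comm]
    simp [← Finset.sum_mul, hcol]
  rw [t1, t2, t3, t4] at h
  simp_rw [e, Finset.sum_sub_distrib, Finset.sum_add_distrib]
  linarith

theorem Design.laplacian_isSymm (D : Design K) : D.laplacian.IsSymm := by
  ext i j
  by_cases h : i = j
  · subst h; rfl
  · simp [laplacian, h, Ne.symm h, D.count_symm j i]

theorem Design.laplacian_mulVec_one (D : Design K) : D.laplacian *ᵥ 1 = 0 := by
  ext i
  have h : ∀ j, D.laplacian i j = (if i = j then ∑ l, (D.count i l : ℝ) else 0) -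
      (D.count i j : ℝ) := fun j => by
    by_cases h : i = j
    · subst h; simp [laplacian, D.count_self]
    · simp [laplacian, h]
  simp [mulVec, dotProduct, h]

theorem Design.laplacian_pair (D : Design K) (p : Pair K) :
    D.laplacian p.1.1 p.1.2 = -(D.count p.1.1 p.1.2 : ℝ) := by
  simp [laplacian, p.2.ne]

/-! ### Regularisation by the mean matrix -/

/-- The orthogonal projection onto the constant vectors, which replaces a vector by its mean. -/
noncomputable def meanMatrix (K : ℕ) : Matrix (Fin K) (Fin K) ℝ := of fun _ _ => (K : ℝ)⁻¹

theorem meanMatrix_mulVec (x : Fin K → ℝ) : meanMatrix K *ᵥ x = fun _ => (K : ℝ)⁻¹ * ∑ i, x i := by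
  ext i
  simp [meanMatrix, mulVec, dotProduct, Finset.mul_sum]

theorem meanMatrix_transpose : (meanMatrix K)ᵀ = meanMatrix K := rfl

theorem meanMatrix_mul_self [NeZero K] : meanMatrix K * meanMatrix K = meanMatrix K := by
  ext i j
  have hK : (K : ℝ) ≠ 0 := NeZero.ne _
  simp [meanMatrix, mul_apply, hK]

theorem mul_meanMatrix {A : Matrix (Fin K) (Fin K) ℝ} (h1 : A *ᵥ 1 = 0) : A * meanMatrix K = 0 := by
  ext i j
  have : ∑ l, A i l = 0 := by simpa [mulVec, dotProduct] using congrFun h1 i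
  simp [meanMatrix, mul_apply, ← Finset.sum_mul, this]

theorem meanMatrix_mul {A : Matrix (Fin K) (Fin K) ℝ} (hA : A.IsSymm) (h1 : A *ᵥ 1 = 0) :
    meanMatrix K * A = 0 := by
  have h := congrArg transpose (mul_meanMatrix h1)
  rwa [transpose_mul, meanMatrix_transpose, hA.eq, transpose_zero] at h

/-- Adding the mean matrix removes a kernel that consists of constant vectors only. -/
theorem isUnit_add_meanMatrix [NeZero K] {A : Matrix (Fin K) (Fin K) ℝ} (hA : A.IsSymm)
    (h1 : A *ᵥ 1 = 0) (hker : ∀ x, A *ᵥ x = 0 → ∀ i j, x i = x j) :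
    IsUnit (A + meanMatrix K) := by
  rw [← mulVec_injective_iff_isUnit]
  refine (injective_iff_map_eq_zero (mulVecLin (A + meanMatrix K))).2 fun x hx => ?_
  rw [mulVecLin_apply] at hx
  have hm : meanMatrix K *ᵥ x = 0 := by
    have h := congrArg (meanMatrix K *ᵥ ·) hx
    simpa [mulVec_mulVec, mul_add, meanMatrix_mul hA h1, meanMatrix_mul_self] using h
  rw [add_mulVec, hm, add_zero] at hx
  ext i
  have hi := congrFun hm i
  have hsum : ∑ j, x j = K * x i := by
    rw [Finset.sum_congr rfl fun j _ => hker x hx j i]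
    simp
  have hK : (K : ℝ) ≠ 0 := NeZero.ne _
  rw [meanMatrix_mulVec, hsum, inv_mul_cancel_left₀ hK] at hi
  exact hi

theorem inv_add_meanMatrix_mul_meanMatrix [NeZero K] {A : Matrix (Fin K) (Fin K) ℝ}
    (h1 : A *ᵥ 1 = 0) (hU : IsUnit (A + meanMatrix K)) :
    (A + meanMatrix K)⁻¹ * meanMatrix K = meanMatrix K := by
  have hd := (isUnit_iff_isUnit_det _).1 hU
  have h : (A + meanMatrix K) * meanMatrix K = meanMatrix K := by
    rw [add_mul, mul_meanMatrix h1, meanMatrix_mul_self, zero_add]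
  have h2 := nonsing_inv_mul_cancel_left (A + meanMatrix K) (meanMatrix K) hd
  rwa [h] at h2

/-- For a symmetric `A` with zero row sums and `A + J` invertible (`J` the mean matrix), the
Moore–Penrose inverse is `(A + J)⁻¹ - J`. The second form shows that it is positive semidefinite
when `A` is. -/
theorem isMoorePenrose_inv_add_meanMatrix [NeZero K] {A : Matrix (Fin K) (Fin K) ℝ}
    (hA : A.IsSymm) (h1 : A *ᵥ 1 = 0) (hU : IsUnit (A + meanMatrix K)) :
    IsMoorePenrose A ((A + meanMatrix K)⁻¹ - meanMatrix K) ∧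
      (A + meanMatrix K)⁻¹ * A * (A + meanMatrix K)⁻¹ =
        (A + meanMatrix K)⁻¹ - meanMatrix K := by
  have hd := (isUnit_iff_isUnit_det _).1 hU
  have hBJ := inv_add_meanMatrix_mul_meanMatrix h1 hU
  have hAJ := mul_meanMatrix h1
  have hJA := meanMatrix_mul hA h1
  have hJJ := meanMatrix_mul_self (K := K)
  set J := meanMatrix K
  set B := (A + J)⁻¹ with hB
  have hBt : Bᵀ = B := by
    rw [hB, transpose_nonsing_inv, transpose_add, hA.eq, meanMatrix_transpose]
  have hJB : J * B = J := by
    have h := congrArg transpose hBJ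
    rwa [transpose_mul, hBt, meanMatrix_transpose] at h
  have hAB : A * B = 1 - J := by
    rw [eq_sub_iff_add_eq, ← mul_nonsing_inv _ hd, ← hB, add_mul, hJB]
  have hBA : B * A = 1 - J := by
    rw [eq_sub_iff_add_eq, ← nonsing_inv_mul _ hd, ← hB, mul_add, hBJ]
  have hl : A * (B - J) = 1 - J := by rw [mul_sub, hAB, hAJ, sub_zero]
  have hr : (B - J) * A = 1 - J := by rw [sub_mul, hBA, hJA, sub_zero]
  have hJt : (1 - J)ᵀ = 1 - J := by rw [transpose_sub, transpose_one, meanMatrix_transpose]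
  refine ⟨⟨?_, ?_, ?_, ?_⟩, ?_⟩
  · rw [hl, sub_mul, one_mul, hJA, sub_zero]
  · rw [hr, sub_mul, one_mul, mul_sub, hJB, hJJ, sub_self, sub_zero]
  · rw [hl, hJt]
  · rw [hr, hJt]
  · rw [hBA, sub_mul, one_mul, hJB]

theorem rank_eq_sub_one [NeZero K] {A : Matrix (Fin K) (Fin K) ℝ}
    (h1 : A *ᵥ 1 = 0) (hker : ∀ x, A *ᵥ x = 0 → ∀ i j, x i = x j) : A.rank = K - 1 := by
  have hk : LinearMap.ker A.mulVecLin = Submodule.span ℝ {(1 : Fin K → ℝ)} := by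
    ext x
    rw [LinearMap.mem_ker, mulVecLin_apply, Submodule.mem_span_singleton]
    constructor
    · intro hx
      exact ⟨x 0, funext fun i => by simp [hker x hx i 0]⟩
    · rintro ⟨a, rfl⟩
      rw [mulVec_smul, h1, smul_zero]
  have h := A.mulVecLin.finrank_range_add_finrank_ker
  rw [hk, finrank_span_singleton one_ne_zero, Module.finrank_fintype_fun_eq_card,
    Fintype.card_fin] at h
  rw [Matrix.rank]
  omega

/-! ### The limiting Laplacian -/

section LimitingLaplacian

variable {D : ℕ → Design K} {Θ : Matrix (Fin K) (Fin K) ℝ}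

theorem isSymm_of_tendsto_laplacian
    (hΘ : Tendsto (fun t => ((D t).total : ℝ)⁻¹ • (D t).laplacian) atTop (𝓝 Θ)) : Θ.IsSymm := by
  have h := (continuous_id.matrix_transpose.tendsto Θ).comp hΘ
  refine tendsto_nhds_unique (h.congr fun t => ?_) hΘ
  simp [transpose_smul, (D t).laplacian_isSymm.eq]

theorem mulVec_one_of_tendsto_laplacian
    (hΘ : Tendsto (fun t => ((D t).total : ℝ)⁻¹ • (D t).laplacian) atTop (𝓝 Θ)) :
    Θ *ᵥ 1 = 0 := by
  have hc : Continuous fun A : Matrix (Fin K) (Fin K) ℝ => A *ᵥ (1 : Fin K → ℝ) := by fun_prop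
  have h := (hc.tendsto Θ).comp hΘ
  refine tendsto_nhds_unique h (tendsto_const_nhds.congr fun t => ?_)
  simp [smul_mulVec, (D t).laplacian_mulVec_one]

theorem tendsto_count_div_total
    (hΘ : Tendsto (fun t => ((D t).total : ℝ)⁻¹ • (D t).laplacian) atTop (𝓝 Θ)) (p : Pair K) :
    Tendsto (fun t => ((D t).count p.1.1 p.1.2 : ℝ) / ((D t).total : ℝ)) atTop
      (𝓝 (-Θ p.1.1 p.1.2)) := by
  have hc : Continuous fun A : Matrix (Fin K) (Fin K) ℝ => -A p.1.1 p.1.2 := by fun_prop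
  refine ((hc.tendsto Θ).comp hΘ).congr fun t => ?_
  simp [(D t).laplacian_pair, div_eq_inv_mul]

theorem neg_apply_pair_nonneg
    (hΘ : Tendsto (fun t => ((D t).total : ℝ)⁻¹ • (D t).laplacian) atTop (𝓝 Θ)) (p : Pair K) :
    0 ≤ -Θ p.1.1 p.1.2 :=
  ge_of_tendsto' (tendsto_count_div_total hΘ p) fun _ => by positivity

theorem posSemidef_of_tendsto_laplacian
    (hΘ : Tendsto (fun t => ((D t).total : ℝ)⁻¹ • (D t).laplacian) atTop (𝓝 Θ)) :
    Θ.PosSemidef := by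
  have hs := isSymm_of_tendsto_laplacian hΘ
  refine .of_dotProduct_mulVec_nonneg (by simpa [IsHermitian] using hs.eq) fun x => ?_
  rw [star_trivial, dotProduct_mulVec_eq_sum_pair hs (mulVec_one_of_tendsto_laplacian hΘ)]
  exact Finset.sum_nonneg fun p _ =>
    mul_nonneg (neg_apply_pair_nonneg hΘ p) (mul_self_nonneg _)

/-- Every edge of the spanning tree keeps a share of at least `c` of the comparisons in the limit,
so a vector in the kernel takes equal values along tree edges, hence everywhere. -/
theorem SpanningTreeRate.eq_of_mulVec_eq_zero (hD : SpanningTreeRate D)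
    (hΘ : Tendsto (fun t => ((D t).total : ℝ)⁻¹ • (D t).laplacian) atTop (𝓝 Θ))
    (x : Fin K → ℝ) (hx : Θ *ᵥ x = 0) (i j : Fin K) : x i = x j := by
  obtain ⟨T, hT, c, hc, hlim⟩ := hD
  have hq := dotProduct_mulVec_eq_sum_pair (isSymm_of_tendsto_laplacian hΘ)
    (mulVec_one_of_tendsto_laplacian hΘ) x x
  rw [hx, dotProduct_zero, eq_comm, Finset.sum_eq_zero_iff_of_nonneg fun p _ =>
    mul_nonneg (neg_apply_pair_nonneg hΘ p) (mul_self_nonneg _)] at hq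
  have hpair : ∀ p : Pair K, T.Adj p.1.1 p.1.2 → x p.1.1 = x p.1.2 := fun p hp => by
    have hle : c ≤ -Θ p.1.1 p.1.2 := by
      refine le_of_tendsto_of_tendsto' hlim (tendsto_count_div_total hΘ p) fun t => ?_
      have : (D t).minCount T ≤ (D t).count p.1.1 p.1.2 := Nat.sInf_le ⟨_, _, hp, rfl⟩
      gcongr
    rcases mul_eq_zero.1 (hq p (Finset.mem_univ p)) with h | h
    · linarith
    · exact sub_eq_zero.1 (mul_self_eq_zero.1 h)
  have hadj : ∀ a b, T.Adj a b → x a = x b := fun a b hab => by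
    rcases lt_or_gt_of_ne hab.ne with h | h
    · exact hpair ⟨(a, b), h⟩ hab
    · exact (hpair ⟨(b, a), h⟩ hab.symm).symm
  obtain ⟨w⟩ := hT.connected.preconnected i j
  induction w with
  | nil => rfl
  | cons hab _ ih => exact (hadj _ _ hab).trans ih

end LimitingLaplacian

/-! ### The normal equations -/

/-- The normal equations, tested against an arbitrary direction `h`. Differences are blind to
constants, so `h` need not sum to zero. -/
theorem IsLSE.normal_eq {D : Design K} {y : Pair K → ℕ → ℝ} {m : EuclideanSpace ℝ (Fin K)}
    (hm : IsLSE D y m) (h : Fin K → ℝ) :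
    ∑ p : Pair K, ∑ k ∈ Finset.range (D.count p.1.1 p.1.2),
      (y p k - (m p.1.1 - m p.1.2)) * (h p.1.1 - h p.1.2) = 0 := by
  set B := ∑ p : Pair K, ∑ k ∈ Finset.range (D.count p.1.1 p.1.2),
      (y p k - (m p.1.1 - m p.1.2)) * (h p.1.1 - h p.1.2) with hB
  set C := ∑ p : Pair K, ∑ _k ∈ Finset.range (D.count p.1.1 p.1.2),
      (h p.1.1 - h p.1.2) ^ 2 with hC
  -- Along the line `m + s h` the excess sum of squares is `C s² - 2 B s`, a nonnegative quadratic
  -- in `s`, so its discriminant `4 B²` is nonpositive.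
  have key : ∀ s : ℝ, 0 ≤ C * (s * s) + (-2 * B) * s + 0 := fun s => by
    set g : EuclideanSpace ℝ (Fin K) :=
      m + s • WithLp.toLp 2 (fun i => h i - (K : ℝ)⁻¹ * ∑ j, h j) with hg
    have hsum : ∑ i, g i = 0 := by
      rcases eq_or_ne (K : ℝ) 0 with hK | hK
      · have : K = 0 := by exact_mod_cast hK
        subst this
        simp
      · simp [hg, Finset.sum_add_distrib, hm.1, ← Finset.mul_sum, Finset.sum_sub_distrib,
          mul_inv_cancel_left₀ hK]
    have hQ : sumSq D y g = sumSq D y m + (-2 * s * B + s ^ 2 * C) := by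
      simp_rw [sumSq, hB, hC, Finset.mul_sum, ← Finset.sum_add_distrib]
      refine Finset.sum_congr rfl fun p _ => Finset.sum_congr rfl fun k _ => ?_
      simp only [hg, PiLp.add_apply, PiLp.smul_apply, smul_eq_mul]
      ring
    have := hm.2 g hsum
    rw [hQ] at this
    linarith
  have := discrim_le_zero key
  rw [discrim] at this
  nlinarith [sq_nonneg B]

/-- A linear functional of the rescaled estimation error, its coefficient vector written as the
image of `y` under the regularised Laplacian, is a weighted sum of the errors: the mean matrix
annihilates the estimation error, and on the Laplacian part the normal equations in direction `y`
apply. A design without comparisons is no exception: both sides are then `0`. -/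
theorem IsLSE.dotProduct_sqrt_total_smul {Ω : Type*} {D : Design K}
    {μ m : EuclideanSpace ℝ (Fin K)} (hμ : ∑ i, μ i = 0) {ε : Pair K → ℕ → Ω → ℝ} {ω : Ω}
    (hm : IsLSE D (outcome μ ε ω) m) (y : Fin K → ℝ) :
    (((D.total : ℝ)⁻¹ • D.laplacian + meanMatrix K) *ᵥ y) ⬝ᵥ
        (fun i => √(D.total : ℝ) * (m i - μ i)) =
      ∑ p : Pair K, ∑ k ∈ Finset.range (D.count p.1.1 p.1.2),
        ((√(D.total : ℝ))⁻¹ * (y p.1.1 - y p.1.2)) * ε p k ω := by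
  set n : ℝ := (D.total : ℝ)
  have hz : (fun i => √n * (m i - μ i)) = √n • fun i => m i - μ i := rfl
  have hJ : (meanMatrix K *ᵥ y) ⬝ᵥ (fun i => m i - μ i) = 0 := by
    rw [meanMatrix_mulVec]
    simp [dotProduct, ← Finset.mul_sum, Finset.sum_sub_distrib, hm.1, hμ]
  have hN := dotProduct_mulVec_eq_sum_pair D.laplacian_isSymm D.laplacian_mulVec_one
    (fun i => m i - μ i) y
  have hne := hm.normal_eq y
  have hsum : (fun i => m i - μ i) ⬝ᵥ D.laplacian *ᵥ y =
      ∑ p : Pair K, ∑ k ∈ Finset.range (D.count p.1.1 p.1.2), (y p.1.1 - y p.1.2) * ε p k ω := by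
    rw [hN, ← sub_eq_zero, ← neg_eq_zero, ← hne, ← Finset.sum_sub_distrib,
      ← Finset.sum_neg_distrib]
    refine Finset.sum_congr rfl fun p _ => ?_
    have hk : ∀ k, (outcome μ ε ω p k - (m p.1.1 - m p.1.2)) * (y p.1.1 - y p.1.2) =
        (y p.1.1 - y p.1.2) * ε p k ω -
          (m p.1.1 - μ p.1.1 - (m p.1.2 - μ p.1.2)) * (y p.1.1 - y p.1.2) := fun k => by
      rw [outcome]
      ring
    simp_rw [hk, Finset.sum_sub_distrib, Finset.sum_const, Finset.card_range, nsmul_eq_mul,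
      D.laplacian_pair]
    ring
  rw [hz, dotProduct_smul, add_mulVec, add_dotProduct, hJ, add_zero, smul_mulVec, smul_dotProduct,
    dotProduct_comm, hsum, smul_eq_mul, smul_eq_mul, ← mul_assoc, ← div_eq_mul_inv,
    Real.sqrt_div_self', one_div]
  simp_rw [Finset.mul_sum, mul_assoc]

/-! ### Convergence of the characteristic functions of the estimation error -/

theorem charFun_map_eq_charFun_map_inner {Ω E : Type*} [MeasurableSpace Ω] {P : Measure Ω}
    [NormedAddCommGroup E] [InnerProductSpace ℝ E] [MeasurableSpace E] [BorelSpace E]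
    [SecondCountableTopology E] {Z : Ω → E} (hZ : AEMeasurable Z P) (x : E) :
    charFun (P.map Z) x = charFun (P.map fun ω => inner ℝ (Z ω) x) 1 := by
  rw [charFun_apply, charFun_apply_real, integral_map hZ (by fun_prop),
    integral_map (by fun_prop) (by fun_prop)]
  simp

/-- The characteristic function of the rescaled estimation error factors over the pairs, and
every factor converges. The limit is that of a centred Gaussian with covariance `σ ^ 2 • Θ⁺`, with
`Θ⁺` in the form `(Θ + J)⁻¹ * Θ * (Θ + J)⁻¹`, `J` being the mean matrix. -/
theorem tendsto_charFun_sqrt_smul_lse {Ω : Type*} [MeasurableSpace Ω] {P : Measure Ω}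
    [IsProbabilityMeasure P] [NeZero K] {σ : ℝ}
    {μ : EuclideanSpace ℝ (Fin K)} (hμ : ∑ i, μ i = 0)
    {ε : Pair K → ℕ → Ω → ℝ} (hε : IIDErrors ε P σ) {D : ℕ → Design K}
    (hn : Tendsto (fun t => (D t).total) atTop atTop) {Θ : Matrix (Fin K) (Fin K) ℝ}
    (hΘ : Tendsto (fun t => ((D t).total : ℝ)⁻¹ • (D t).laplacian) atTop (𝓝 Θ))
    (hU : IsUnit (Θ + meanMatrix K))
    {μhat : ℕ → Ω → EuclideanSpace ℝ (Fin K)} (hmeas : ∀ t, AEMeasurable (μhat t) P)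
    (hlse : ∀ t, ∀ᵐ ω ∂P, IsLSE (D t) (outcome μ ε ω) (μhat t ω))
    (x : EuclideanSpace ℝ (Fin K)) :
    Tendsto (fun t => charFun (P.map fun ω => √((D t).total : ℝ) • (μhat t ω - μ)) x) atTop
      (𝓝 (Complex.exp (-((σ ^ 2 * (x ⬝ᵥ ((Θ + meanMatrix K)⁻¹ * Θ * (Θ + meanMatrix K)⁻¹) *ᵥ x)
        / 2 : ℝ) : ℂ)))) := by
  have hd := (isUnit_iff_isUnit_det _).1 hU
  have hsym := isSymm_of_tendsto_laplacian hΘ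
  have hrow := mulVec_one_of_tendsto_laplacian hΘ
  set A : ℕ → Matrix (Fin K) (Fin K) ℝ :=
    fun t => ((D t).total : ℝ)⁻¹ • (D t).laplacian + meanMatrix K with hA
  have hAlim : Tendsto A atTop (𝓝 (Θ + meanMatrix K)) := hΘ.add_const _
  set y : ℕ → Fin K → ℝ := fun t => (A t)⁻¹ *ᵥ x with hy
  set z : Fin K → ℝ := (Θ + meanMatrix K)⁻¹ *ᵥ x with hz
  have hylim : Tendsto y atTop (𝓝 z) := by
    have h1 : Tendsto (fun t => (A t)⁻¹) atTop (𝓝 (Θ + meanMatrix K)⁻¹) := by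
      have hc : ContinuousAt Inv.inv (Θ + meanMatrix K) := by
        refine continuousAt_matrix_inv _ ?_
        rw [Ring.inverse_eq_inv']
        exact continuousAt_inv₀ hd.ne_zero
      exact hc.tendsto.comp hAlim
    have hc : Continuous fun B : Matrix (Fin K) (Fin K) ℝ => B *ᵥ (x : Fin K → ℝ) := by fun_prop
    exact (hc.tendsto _).comp h1
  have hdet : ∀ᶠ t in atTop, IsUnit (A t).det := by
    have h := (continuous_id.matrix_det.tendsto (Θ + meanMatrix K)).comp hAlim
    filter_upwards [h.eventually_ne hd.ne_zero] with t ht using isUnit_iff_ne_zero.2 ht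
  have hncast : Tendsto (fun t => ((D t).total : ℝ)) atTop atTop :=
    tendsto_natCast_atTop_atTop.comp hn
  have hdiff : ∀ p : Pair K,
      Tendsto (fun t => y t p.1.1 - y t p.1.2) atTop (𝓝 (z p.1.1 - z p.1.2)) := fun p =>
    (tendsto_pi_nhds.1 hylim _).sub (tendsto_pi_nhds.1 hylim _)
  -- `n_ij ((y_i - y_j) / √n)² = (n_ij / n) (y_i - y_j)²` converges, whether or not `n_ij → ∞`.
  have hfac : ∀ p : Pair K, Tendsto (fun t => charFun (P.map (ε p 0))
      ((√((D t).total : ℝ))⁻¹ * (y t p.1.1 - y t p.1.2)) ^ (D t).count p.1.1 p.1.2) atTop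
      (𝓝 (Complex.exp (-((σ ^ 2 : ℝ) *
        (-Θ p.1.1 p.1.2 * (z p.1.1 - z p.1.2) ^ 2 : ℝ) / 2 : ℂ)))) := fun p => by
    rw [← hε.variance_eq p 0]
    refine tendsto_charFun_pow (hε.memLp p 0) (hε.mean_zero p 0) ?_ ?_
    · have h := (tendsto_inv_atTop_zero.comp (Real.tendsto_sqrt_atTop.comp hncast)).mul (hdiff p)
      rwa [zero_mul] at h
    · refine ((tendsto_count_div_total hΘ p).mul ((hdiff p).pow 2)).congr fun t => ?_
      rw [mul_pow, inv_pow, Real.sq_sqrt (Nat.cast_nonneg _)]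
      ring
  have hprod := tendsto_finsetProd (Finset.univ : Finset (Pair K)) fun p _ => hfac p
  rw [← Complex.exp_sum] at hprod
  have hval : ∑ p : Pair K, -((σ ^ 2 : ℝ) *
      (-Θ p.1.1 p.1.2 * (z p.1.1 - z p.1.2) ^ 2 : ℝ) / 2 : ℂ) =
      -((σ ^ 2 * (x ⬝ᵥ ((Θ + meanMatrix K)⁻¹ * Θ * (Θ + meanMatrix K)⁻¹) *ᵥ x) / 2 : ℝ) : ℂ) := by
    have hq : (x : Fin K → ℝ) ⬝ᵥ ((Θ + meanMatrix K)⁻¹ * Θ * (Θ + meanMatrix K)⁻¹) *ᵥ x =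
        ∑ p : Pair K, -Θ p.1.1 p.1.2 * (z p.1.1 - z p.1.2) ^ 2 := by
      have hBt : ((Θ + meanMatrix K)⁻¹)ᵀ = (Θ + meanMatrix K)⁻¹ := by
        rw [transpose_nonsing_inv, transpose_add, hsym.eq, meanMatrix_transpose]
      rw [Matrix.mul_assoc, ← mulVec_mulVec, ← mulVec_mulVec, dotProduct_mulVec, ← mulVec_transpose,
        hBt, ← hz, dotProduct_mulVec_eq_sum_pair hsym hrow]
      simp_rw [sq]
    rw [hq, Finset.mul_sum, Finset.sum_div]
    push_cast
    rw [← Finset.sum_neg_distrib]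
  rw [hval] at hprod
  refine hprod.congr' ?_
  filter_upwards [hdet] with t ht
  have hAy : A t *ᵥ y t = x := by
    rw [hy, mulVec_mulVec, mul_nonsing_inv _ ht, one_mulVec]
  have hmt : AEMeasurable (fun ω => √((D t).total : ℝ) • (μhat t ω - μ)) P :=
    ((hmeas t).sub_const μ).fun_const_smul _
  rw [charFun_map_eq_charFun_map_inner hmt]
  have hae : (fun ω => inner ℝ (√((D t).total : ℝ) • (μhat t ω - μ)) x) =ᵐ[P]
      fun ω => ∑ p : Pair K, ∑ k ∈ Finset.range ((D t).count p.1.1 p.1.2),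
        ((√((D t).total : ℝ))⁻¹ * (y t p.1.1 - y t p.1.2)) * ε p k ω := by
    filter_upwards [hlse t] with ω hω
    rw [← hω.dotProduct_sqrt_total_smul hμ (y t)]
    change _ = (A t *ᵥ y t) ⬝ᵥ _
    rw [hAy]
    simp [PiLp.inner_apply, dotProduct]
  rw [Measure.map_congr hae, hε.charFun_sum]
  simp

end PairedComparison

theorem mainTheorem3 {K : ℕ} {Ω : Type*} [MeasurableSpace Ω] (P : Measure Ω)
    [IsProbabilityMeasure P] (σ : ℝ)
    (μ : EuclideanSpace ℝ (Fin K)) (hμ : ∑ i, μ i = 0)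
    (ε : PairedComparison.Pair K → ℕ → Ω → ℝ)
    (hε : PairedComparison.IIDErrors ε P σ)
    (D : ℕ → PairedComparison.Design K)
    (hn : Tendsto (fun t => (D t).total) atTop atTop)
    (hD : PairedComparison.SpanningTreeRate D)
    (Θ : Matrix (Fin K) (Fin K) ℝ)
    (hΘ : Tendsto (fun t => ((D t).total : ℝ)⁻¹ • (D t).laplacian) atTop (𝓝 Θ))
    (μhat : ℕ → Ω → EuclideanSpace ℝ (Fin K))
    (hmeas : ∀ t, AEMeasurable (μhat t) P)
    (hlse : ∀ t, ∀ᵐ ω ∂P,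
      PairedComparison.IsLSE (D t) (PairedComparison.outcome μ ε ω) (μhat t ω)) :
    Θ.rank = K - 1 ∧
      ∃ Θplus : Matrix (Fin K) (Fin K) ℝ, PairedComparison.IsMoorePenrose Θ Θplus ∧
        TendstoInDistribution
          (fun t ω => √((D t).total : ℝ) • (μhat t ω - μ)) atTop
          (id : EuclideanSpace ℝ (Fin K) → EuclideanSpace ℝ (Fin K))
          (fun _ => P) (multivariateGaussian 0 (σ ^ 2 • Θplus)) := by
  open PairedComparison Matrix in
  have hK : NeZero K := by
    obtain ⟨T, hT, -⟩ := hD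
    obtain ⟨i⟩ := hT.connected.nonempty
    exact ⟨fun h => Nat.not_lt_zero i (h ▸ i.isLt)⟩
  have hsym := isSymm_of_tendsto_laplacian hΘ
  have hrow := mulVec_one_of_tendsto_laplacian hΘ
  have hker := hD.eq_of_mulVec_eq_zero hΘ
  have hU := isUnit_add_meanMatrix hsym hrow hker
  obtain ⟨hMP, hsandwich⟩ := isMoorePenrose_inv_add_meanMatrix hsym hrow hU
  refine ⟨rank_eq_sub_one hrow hker, _, hMP, ?_⟩
  have hpsd : (σ ^ 2 • ((Θ + meanMatrix K)⁻¹ - meanMatrix K)).PosSemidef := by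
    refine PosSemidef.smul ?_ (sq_nonneg σ)
    rw [← hsandwich]
    have hBt : ((Θ + meanMatrix K)⁻¹)ᴴ = (Θ + meanMatrix K)⁻¹ := by
      rw [conjTranspose_eq_transpose_of_trivial, transpose_nonsing_inv, transpose_add, hsym.eq,
        meanMatrix_transpose]
    have h := (posSemidef_of_tendsto_laplacian hΘ).mul_mul_conjTranspose_same
      (Θ + meanMatrix K)⁻¹
    rwa [hBt] at h
  refine ⟨fun t => ((hmeas t).sub_const μ).fun_const_smul _, aemeasurable_id, ?_⟩
  refine ProbabilityMeasure.tendsto_iff_tendsto_charFun.2 fun x => ?_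
  have h := tendsto_charFun_sqrt_smul_lse hμ hε hn hΘ hU hmeas hlse x
  rw [hsandwich] at h
  simp only [ProbabilityMeasure.coe_mk, Measure.map_id]
  rw [charFun_multivariateGaussian hpsd]
  convert h using 3
  rw [smul_mulVec, dotProduct_smul, inner_zero_right, smul_eq_mul]
  push_cast
  ring
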